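/- **Notation.** A growth function is a continuous, nondecreasing, surjective map $\Phi:[0,\infty)\to[0,\infty)$. Let $\mathscr U$ be the set of growth functions $\Phi$ such that $t\mapsto\Phi(t)/t$ is nondecreasing on $(0,\infty)$ and, for some $r\ge 1$ and $C>0$, $\Phi(st)\le C t^r\Phi(s)$ for all $s>0$, $t\ge1$. Let $\mathscr L$ be the set of growth functions $\Phi$ such that $t\mapsto\Phi(t)/t$ is nonincreasing on $(0,\infty)$ and, for some $0<r\le 1$ and $C>0$, $\Phi(st)\le C t^r\Phi(s)$ for all $s>0$, $0<t\le1$. For $\varepsilon_1,\varepsilon_2\in\{0,1\}$ put $$\omega(t)=1+\varepsilon_1\ln_+\!\big(\Phi(1/t)\big)+\varepsilon_2\ln_+\!\big(\Phi(t)\big),\qquad t>0,$$ where $\ln_+=\max(\ln,0)$ and $\ln_+0=0$. For $k\in\mathbb R$, $\alpha>-1$ and $1<p,q<\infty$, the space $A^{p,q}_{\omega^k,\alpha}(\mathbb C_+)$ consists of the holomorphic functions $F$ on $\mathbb C_+=\{z\in\mathbb C:\operatorname{Im}z>0\}$ with $$\|F\|^q_{A^{p,q}_{\omega^k,\alpha}}=\int_0^\infty\Big(\int_{\mathbb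 R}|F(x+iy)|^p\,dx\Big)^{q/p}\omega^k(y)\,y^\alpha\,dy<\infty .$$ For $0<\delta<1$ let $\gamma$ be any real number with $$\frac{1}{4\log2}\log\frac{1+\delta^2/20}{1-\delta^2/20}<\gamma<\frac{1}{4\log2}\log\frac{1+\delta^2/4}{1-\delta^2/4},$$ and let $z_{l,j}=\frac{\delta^2}{4}\,l\,2^{\gamma j-1}+i\,2^{\gamma j}$, $l,j\in\mathbb Z$, be the associated $\delta$-lattice. **Theorem.** Let $\alpha>-1$, $1<p,q<\infty$, $k\in\mathbb R$, $\Phi\in\mathscr L\cup\mathscr U$, $\varepsilon_1,\varepsilon_2\in\{0,1\}$, and let $\omega$ be as above; all of these are fixed. For every $0<\delta<1$ there is a constant $C_\delta>0$, independent of the choice of $\gamma$ and of $F$, such that for every $F\in A^{p,q}_{\omega^k,\alpha}(\mathbb C_+)$ $$\sum_{j\in\mathbb Z}\Big(\sum_{l\in\mathbb Z}|F(z_{l,j})|^p\Big)^{q/p}\omega^k(2^{\gamma j})\,2^{\gamma j(\alpha+1+q/p)}\le C_\delta\,\|F\|^q_{A^{p,q}_{\omega^k,\alpha}} .$$ Moreover,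 there is $\delta_0>0$ such that, if in addition $\delta<\delta_0$, then for every $F\in A^{p,q}_{\omega^k,\alpha}(\mathbb C_+)$ the converse inequality also holds: $$\|F\|^q_{A^{p,q}_{\omega^k,\alpha}}\le C_\delta\sum_{j\in\mathbb Z}\Big(\sum_{l\in\mathbb Z}|F(z_{l,j})|^p\Big)^{q/p}\omega^k(2^{\gamma j})\,2^{\gamma j(\alpha+1+q/p)} .$$ -/

import Mathlib

open MeasureTheory Set
open scoped NNReal ENNReal

noncomputable section

namespace MixedBergman

/-! ### Growth functions and the weights -/

/-- A growth function: a continuous, nondecreasing map of `[0, ∞)` onto itself, not identically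
zero. -/
structure IsGrowthFunction (Φ : ℝ≥0 → ℝ≥0) : Prop where
  ne_zero : Φ ≠ 0
  continuous : Continuous Φ
  monotone : Monotone Φ
  surjective : Function.Surjective Φ

/-- `Φ` is of upper-type `r`: `Φ (s t) ≤ C t ^ r Φ s` for all `s > 0` and all `t ≥ 1`. -/
def IsOfUpperType (r : ℝ) (Φ : ℝ≥0 → ℝ≥0) : Prop :=
  ∃ C : ℝ≥0, 0 < C ∧ ∀ t : ℝ≥0, 1 ≤ t → ∀ s : ℝ≥0, 0 < s → Φ (s * t) ≤ C * t ^ r * Φ s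

/-- `Φ` is of lower-type `r`: `Φ (s t) ≤ C t ^ r Φ s` for all `s > 0` and all `0 < t ≤ 1`. -/
def IsOfLowerType (r : ℝ) (Φ : ℝ≥0 → ℝ≥0) : Prop :=
  ∃ C : ℝ≥0, 0 < C ∧
    ∀ t : ℝ≥0, 0 < t → t ≤ 1 → ∀ s : ℝ≥0, 0 < s → Φ (s * t) ≤ C * t ^ r * Φ s

/-- The class `𝒰`: the union over `r ≥ 1` of the classes `𝒰^r` of growth functions of upper-type
`r` for which `t ↦ Φ t / t` is nondecreasing on `(0, ∞)`. -/
def classU : Set (ℝ≥0 → ℝ≥0) :=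
  {Φ | ∃ r : ℝ, 1 ≤ r ∧ IsGrowthFunction Φ ∧ IsOfUpperType r Φ ∧
    MonotoneOn (fun t : ℝ≥0 => Φ t / t) (Ioi 0)}

/-- The class `ℒ`: the union over `0 < r ≤ 1` of the classes `ℒ_r` of growth functions of
lower-type `r` for which `t ↦ Φ t / t` is nonincreasing on `(0, ∞)`. -/
def classL : Set (ℝ≥0 → ℝ≥0) :=
  {Φ | ∃ r : ℝ, 0 < r ∧ r ≤ 1 ∧ IsGrowthFunction Φ ∧ IsOfLowerType r Φ ∧
    AntitoneOn (fun t : ℝ≥0 => Φ t / t) (Ioi 0)}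

/-- The weight `1 + ε₁ ln₊ (Φ (1 / t)) + ε₂ ln₊ (Φ t)`, meant for `t > 0`. -/
def growthWeight (Φ : ℝ≥0 → ℝ≥0) (ε₁ ε₂ : ℝ) (t : ℝ) : ℝ :=
  1 + ε₁ * Real.posLog (Φ (1 / t).toNNReal : ℝ) + ε₂ * Real.posLog (Φ t.toNNReal : ℝ)

/-! ### Mixed norm Bergman spaces of the upper half-plane -/

/-- The `q`-th power of the mixed norm of `f`,
`∫₀^∞ (∫_ℝ |f (x + i y)| ^ p dx) ^ (q / p) Ω y y ^ α dy`, as an extended nonnegative number. -/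
def mixedNormPow (Ω : ℝ → ℝ) (α p q : ℝ) (f : ℂ → ℂ) : ℝ≥0∞ :=
  ∫⁻ y in Ioi (0 : ℝ),
    (∫⁻ x : ℝ, ‖f ((x : ℂ) + (y : ℂ) * Complex.I)‖ₑ ^ p) ^ (q / p) *
      ENNReal.ofReal (Ω y * y ^ α)

/-- The mixed norm Lebesgue space `L^{p,q}_{Ω,α}` of the upper half-plane. The values of `f` off
the upper half-plane play no role. -/
def mixedLebesgue (Ω : ℝ → ℝ) (α p q : ℝ) : Set (ℂ → ℂ) :=
  {f | Measurable ({z : ℂ | 0 < z.im}.domRestrict f) ∧ mixedNormPow Ω α p q f < ∞}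

/-- The mixed norm Bergman space `A^{p,q}_{Ω,α}` of the upper half-plane. -/
def mixedBergman (Ω : ℝ → ℝ) (α p q : ℝ) : Set (ℂ → ℂ) :=
  mixedLebesgue Ω α p q ∩ {f | DifferentiableOn ℂ f {z : ℂ | 0 < z.im}}

/-! ### The lattice -/

/-- The reals `γ` allowed in the definition of the `δ`-lattice. -/
def IsLatticeExponent (δ γ : ℝ) : Prop :=
  Real.log ((1 + δ ^ 2 / 20) / (1 - δ ^ 2 / 20)) / (4 * Real.log 2) < γ ∧
    γ < Real.log ((1 + δ ^ 2 / 4) / (1 - δ ^ 2 / 4)) / (4 * Real.log 2)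

/-- The point `z_{l,j} = (δ² / 4) l 2^{γ j - 1} + i 2^{γ j}` of the `δ`-lattice. -/
def latticePoint (δ γ : ℝ) (l j : ℤ) : ℂ :=
  ((δ ^ 2 / 4 * (l : ℝ) * (2 : ℝ) ^ (γ * (j : ℝ) - 1) : ℝ) : ℂ) +
    (((2 : ℝ) ^ (γ * (j : ℝ)) : ℝ) : ℂ) * Complex.I

/-- The discrete quantity
`∑_j (∑_l |F z_{l,j}| ^ p) ^ (q / p) Ω (2^{γ j}) 2^{γ j (α + 1 + q / p)}`, as an extended
nonnegative number. -/
def discreteNormPow (Ω : ℝ → ℝ) (α p q δ γ : ℝ) (F : ℂ → ℂ) : ℝ≥0∞ :=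
  ∑' j : ℤ, (∑' l : ℤ, ‖F (latticePoint δ γ l j)‖ₑ ^ p) ^ (q / p) *
    ENNReal.ofReal
      (Ω ((2 : ℝ) ^ (γ * (j : ℝ))) * (2 : ℝ) ^ (γ * (j : ℝ) * (α + 1 + q / p)))

end MixedBergman

end

noncomputable section

namespace MixedBergman

/-! ### Minkowski's integral inequality -/

section Minkowski

variable {X Y : Type*} [MeasurableSpace X] [MeasurableSpace Y] {μ : Measure X} {ν : Measure Y}

/-! Cut the half-plane into cells of size about `δ² y` at height `y`, each with a lattice point as
lower left corner. Since `Ω y * y ^ α` changes by at most a fixed factor when `y` changes by a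
factor of at most 4, the discrete sum is comparable, with constants depending on `δ` but not on `γ`,
to the mixed norm of the step function `F ∘ corner` (`discrete_bounds`).

It remains to compare `F` with its step function. By Cauchy's formula on the circle of radius `3 y /
4`, the oscillation of `F` over a cell is at most `5 δ²` times a circular integral of `|F|`
(`enorm_sub_le_circleMean`). Minkowski's inequality, first in `x` and then in `y`, bounds that
circular integral on the mixed norm space by a constant free of `δ` (`mixedPow_circleMean_le`). The
triangle inequality up to a constant then gives the sampling estimate for every `δ`. For the
converse, the error is a small multiple of the norm of `F` once `δ` is small, and it is absorbed
because that norm is finite. -/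

theorem lintegral_rpow_le_of_le_lintegral [SFinite μ] [SFinite ν] {p : ℝ} (hp : 1 < p)
    {f : X → Y → ℝ≥0∞} (hf : Measurable (Function.uncurry f)) {h : X → ℝ≥0∞} (hh : Measurable h)
    (hle : ∀ x, h x ≤ ∫⁻ y, f x y ∂ν) (hfin : ∫⁻ x, h x ^ p ∂μ ≠ ∞) :
    (∫⁻ x, h x ^ p ∂μ) ^ (1 / p) ≤ ∫⁻ y, (∫⁻ x, f x y ^ p ∂μ) ^ (1 / p) ∂ν := by
  set I := ∫⁻ x, h x ^ p ∂μ with hI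
  have hpq : p.HolderConjugate (Real.conjExponent p) := Real.HolderConjugate.conjExponent hp
  set p' := Real.conjExponent p
  have hp0 : 0 < p := by linarith
  rcases eq_or_ne I 0 with h0 | h0
  · rw [h0, ENNReal.zero_rpow_of_pos (by positivity)]; exact zero_le
  -- Write `h ^ p = h * h ^ (p - 1)`, bound the first factor by the integral of `f`, exchange the
  -- integrals and apply Hölder in `x`. Dividing by `I ^ (1 / p')` is legitimate because `0 < I <
  -- ∞`.
  have key : I ≤ (∫⁻ y, (∫⁻ x, f x y ^ p ∂μ) ^ (1 / p) ∂ν) * I ^ (1 / p') := by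
    calc I ≤ ∫⁻ x, ∫⁻ y, f x y * h x ^ (p - 1) ∂ν ∂μ := by
          refine lintegral_mono fun x => ?_
          rw [lintegral_mul_const (f := fun y => f x y) _ (hf.comp measurable_prodMk_left)]
          calc h x ^ p = h x * h x ^ (p - 1) := by
                conv_lhs => rw [show p = 1 + (p - 1) by ring]
                rw [ENNReal.rpow_add_of_nonneg _ _ zero_le_one (by linarith), ENNReal.rpow_one]
            _ ≤ _ := by gcongr; exact hle x
      _ = ∫⁻ y, ∫⁻ x, f x y * h x ^ (p - 1) ∂μ ∂ν := by
          refine lintegral_lintegral_swap (Measurable.aemeasurable ?_)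
          exact hf.mul ((hh.comp measurable_fst).pow_const _)
      _ ≤ ∫⁻ y, (∫⁻ x, f x y ^ p ∂μ) ^ (1 / p) * I ^ (1 / p') ∂ν := by
          refine lintegral_mono fun y => ?_
          refine (ENNReal.lintegral_mul_le_Lp_mul_Lq μ hpq
            (hf.comp measurable_prodMk_right).aemeasurable
            (hh.pow_const _).aemeasurable).trans_eq ?_
          congr 3
          ext x
          rw [← ENNReal.rpow_mul, hpq.sub_one_mul_conj]
      _ = _ := by
          rw [lintegral_mul_const]
          exact (hf.pow_const p).lintegral_prod_left'.pow_const _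
  have hsum : I = I ^ (1 / p) * I ^ (1 / p') := by
    rw [← ENNReal.rpow_add _ _ h0 hfin, one_div, one_div, hpq.inv_add_inv_eq_one, ENNReal.rpow_one]
  conv_lhs at key => rw [hsum]
  refine (ENNReal.mul_le_mul_iff_left ?_ ?_).1 key
  · simp [ENNReal.rpow_eq_zero_iff, h0, hfin]
  · exact ENNReal.rpow_ne_top_of_nonneg (by have := hpq.symm.pos; positivity) hfin

/-- **Minkowski's integral inequality**. -/
theorem lintegral_lintegral_rpow_le [SigmaFinite μ] [SFinite ν] {p : ℝ} (hp : 1 < p)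
    {f : X → Y → ℝ≥0∞} (hf : Measurable (Function.uncurry f)) :
    (∫⁻ x, (∫⁻ y, f x y ∂ν) ^ p ∂μ) ^ (1 / p) ≤ ∫⁻ y, (∫⁻ x, f x y ^ p ∂μ) ^ (1 / p) ∂ν := by
  have hp0 : 0 < p := by linarith
  set g : X → ℝ≥0∞ := fun x => ∫⁻ y, f x y ∂ν with hg
  have hgm : Measurable g := hf.lintegral_prod_right'
  -- Truncation in height and in support makes the `p`-th power integrable; monotone convergence
  -- then recovers `g`.
  set h : ℕ → X → ℝ≥0∞ := fun n => (spanningSets μ n).indicator fun x => min (g x) n with hh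
  have hhm : ∀ n, Measurable (h n) := fun n =>
    (hgm.min measurable_const).indicator (measurableSet_spanningSets μ n)
  have hmono : Monotone h := by
    intro m n hmn x
    simp only [hh, indicator]
    by_cases hx : x ∈ spanningSets μ m
    · rw [if_pos hx, if_pos (monotone_spanningSets μ hmn hx)]
      gcongr
    · rw [if_neg hx]; exact zero_le
  have hsup : ∀ x, ⨆ n, h n x ^ p = g x ^ p := by
    intro x
    refine le_antisymm (iSup_le fun n => ?_) ?_
    · gcongr
      simp only [hh, indicator]
      split_ifs
      · exact min_le_left _ _
      · exact zero_le
    · obtain ⟨m, hm⟩ := mem_iUnion.1 ((iUnion_spanningSets μ).symm ▸ mem_univ x)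
      have e : g x = ⨆ n : ℕ, min (g x) (n : ℝ≥0∞) := by
        rw [← inf_iSup_eq, ENNReal.iSup_natCast, inf_top_eq]
      have e2 : g x ≤ ⨆ n, h n x := by
        conv_lhs => rw [e]
        refine iSup_le fun n => le_iSup_of_le (max n m) ?_
        simp only [hh, indicator]
        rw [if_pos (monotone_spanningSets μ (le_max_right n m) hm)]
        gcongr
        exact le_max_left _ _
      calc g x ^ p ≤ (⨆ n, h n x) ^ p := by gcongr
        _ = _ := by
          have := (ENNReal.orderIsoRpow p hp0).map_iSup (fun n => h n x)
          exact this
  have hlim : ∫⁻ x, g x ^ p ∂μ = ⨆ n, ∫⁻ x, h n x ^ p ∂μ := by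
    rw [← lintegral_iSup (fun n => (hhm n).pow_const p)]
    · simp_rw [hsup]
    · intro m n hmn x
      exact ENNReal.rpow_le_rpow (hmono hmn x) hp0.le
  have hB : ∀ n, (∫⁻ x, h n x ^ p ∂μ) ^ (1 / p) ≤ ∫⁻ y, (∫⁻ x, f x y ^ p ∂μ) ^ (1 / p) ∂ν := by
    intro n
    refine lintegral_rpow_le_of_le_lintegral hp hf (hhm n) (fun x => ?_) ?_
    · simp only [hh, indicator]
      split_ifs
      · exact min_le_left _ _
      · exact zero_le
    · refine ne_top_of_le_ne_top (b := ∫⁻ x in spanningSets μ n, (n : ℝ≥0∞) ^ p ∂μ) ?_ ?_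
      · rw [setLIntegral_const]
        exact ENNReal.mul_ne_top (ENNReal.rpow_ne_top_of_nonneg hp0.le (by simp))
          (measure_spanningSets_lt_top μ n).ne
      · rw [← lintegral_indicator (measurableSet_spanningSets μ n)]
        refine lintegral_mono fun x => ?_
        simp only [hh, indicator]
        split_ifs
        · gcongr; exact min_le_right _ _
        · simp [hp0]
  rw [one_div, ENNReal.rpow_inv_le_iff hp0, hlim]
  refine iSup_le fun n => ?_
  rw [← ENNReal.rpow_inv_le_iff hp0, ← one_div]
  exact hB n

end Minkowski

/-! ### Mixed norms of functions of two real variables -/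

/-- The `q`-th power of the mixed norm with weight `W` of `f : (x, y) ↦ f x y`. -/
def mixedPow (W : ℝ → ℝ≥0∞) (p q : ℝ) (f : ℝ → ℝ → ℝ≥0∞) : ℝ≥0∞ :=
  ∫⁻ y in Ioi (0 : ℝ), (∫⁻ x : ℝ, f x y ^ p) ^ (q / p) * W y

theorem mixedNormPow_eq_mixedPow (Ω : ℝ → ℝ) (α p q : ℝ) (F : ℂ → ℂ) :
    mixedNormPow Ω α p q F = mixedPow (fun y => ENNReal.ofReal (Ω y * y ^ α)) p q
      (fun x y => ‖F ((x : ℂ) + (y : ℂ) * Complex.I)‖ₑ) := rfl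

theorem mixedPow_mono {W : ℝ → ℝ≥0∞} {p q : ℝ} (hp : 0 < p) (hq : 0 < q) {f g : ℝ → ℝ → ℝ≥0∞}
    (h : ∀ x y, 0 < y → f x y ≤ g x y) : mixedPow W p q f ≤ mixedPow W p q g := by
  refine setLIntegral_mono' measurableSet_Ioi fun y hy => ?_
  gcongr with x
  exact h x y hy

theorem mixedPow_const_mul {W : ℝ → ℝ≥0∞} {p q : ℝ} (hp : 0 < p) (hq : 0 < q)
    {f : ℝ → ℝ → ℝ≥0∞} {c : ℝ≥0∞} (hc : c ≠ ∞) :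
    mixedPow W p q (fun x y => c * f x y) = c ^ q * mixedPow W p q f := by
  unfold mixedPow
  rw [← lintegral_const_mul' _ _ (ENNReal.rpow_ne_top_of_nonneg hq.le hc)]
  congr 1
  ext y
  simp_rw [ENNReal.mul_rpow_of_nonneg _ _ hp.le]
  rw [lintegral_const_mul' _ _ (ENNReal.rpow_ne_top_of_nonneg hp.le hc),
    ENNReal.mul_rpow_of_nonneg _ _ (by positivity), ← ENNReal.rpow_mul,
    mul_div_cancel₀ _ hp.ne', mul_assoc]

theorem add_rpow_le_two_rpow_mul (a b : ℝ≥0∞) {s : ℝ} (hs : 0 ≤ s) :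
    (a + b) ^ s ≤ 2 ^ s * (a ^ s + b ^ s) := by
  wlog hab : a ≤ b generalizing a b
  · rw [add_comm a, add_comm (a ^ s)]; exact this b a (le_of_not_ge hab)
  calc (a + b) ^ s ≤ (2 * b) ^ s := by rw [two_mul]; gcongr
    _ = 2 ^ s * b ^ s := ENNReal.mul_rpow_of_nonneg _ _ hs
    _ ≤ _ := by gcongr; exact le_add_self

/-- A crude constant suffices: `add_rpow_le_two_rpow_mul` is used with exponent `p` inside and `q /
p` outside. -/
theorem mixedPow_add_le {W : ℝ → ℝ≥0∞} (hW : Measurable W) {p q : ℝ} (hp : 0 < p) (hq : 0 < q)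
    (f : ℝ → ℝ → ℝ≥0∞) {g : ℝ → ℝ → ℝ≥0∞} (hg : Measurable (Function.uncurry g)) :
    mixedPow W p q (fun x y => f x y + g x y) ≤
      2 ^ q * 2 ^ (q / p) * (mixedPow W p q f + mixedPow W p q g) := by
  have hqp : 0 ≤ q / p := by positivity
  unfold mixedPow
  rw [← lintegral_add_right, ← lintegral_const_mul']
  · refine lintegral_mono fun y => ?_
    rw [← add_mul, ← mul_assoc]
    gcongr
    calc (∫⁻ x, (f x y + g x y) ^ p) ^ (q / p)
        ≤ (∫⁻ x, 2 ^ p * (f x y ^ p + g x y ^ p)) ^ (q / p) := by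
          gcongr with x; exact add_rpow_le_two_rpow_mul _ _ hp.le
      _ = 2 ^ q * (∫⁻ x, f x y ^ p + g x y ^ p) ^ (q / p) := by
          rw [lintegral_const_mul' _ _ (ENNReal.rpow_ne_top_of_nonneg hp.le (by simp)),
            ENNReal.mul_rpow_of_nonneg _ _ hqp, ← ENNReal.rpow_mul, mul_div_cancel₀ _ hp.ne']
      _ = 2 ^ q * ((∫⁻ x, f x y ^ p) + ∫⁻ x, g x y ^ p) ^ (q / p) := by
          rw [lintegral_add_right]
          exact (hg.comp measurable_prodMk_right).pow_const p
      _ ≤ _ := by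
          rw [mul_assoc]
          gcongr
          exact add_rpow_le_two_rpow_mul _ _ hqp
  · exact ENNReal.mul_ne_top (ENNReal.rpow_ne_top_of_nonneg hq.le (by simp))
      (ENNReal.rpow_ne_top_of_nonneg hqp (by simp))
  · exact ((hg.pow_const p).lintegral_prod_left'.pow_const _).mul hW

/-! ### Circular means -/

/-- The integral of `G` over the parametrised circle of centre `(x, y)` and radius `3 y / 4`. -/
def circleMean (G : ℝ → ℝ → ℝ≥0∞) (x y : ℝ) : ℝ≥0∞ :=
  ∫⁻ θ in Ioc 0 (2 * Real.pi), G (x + 3 / 4 * y * Real.cos θ) (y + 3 / 4 * y * Real.sin θ)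

theorem measurable_circleMean {G : ℝ → ℝ → ℝ≥0∞} (hG : Measurable (Function.uncurry G)) :
    Measurable (Function.uncurry (circleMean G)) := by
  have h : Measurable fun a : (ℝ × ℝ) × ℝ =>
      (a.1.1 + 3 / 4 * a.1.2 * Real.cos a.2, a.1.2 + 3 / 4 * a.1.2 * Real.sin a.2) := by fun_prop
  exact (hG.comp h).lintegral_prod_right'

theorem setLIntegral_Ioi_comp_mul_left {g : ℝ → ℝ≥0∞} (hg : Measurable g) {c : ℝ} (hc : 0 < c) :
    ∫⁻ y in Ioi (0 : ℝ), g (c * y) = ENNReal.ofReal c⁻¹ * ∫⁻ y in Ioi (0 : ℝ), g y := by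
  rw [← lintegral_indicator measurableSet_Ioi, ← lintegral_indicator measurableSet_Ioi]
  have h := lintegral_map (μ := volume) (hg.indicator (measurableSet_Ioi (a := (0 : ℝ))))
    (measurable_const_mul c)
  rw [Real.map_volume_mul_left hc.ne', lintegral_smul_measure, abs_of_pos (inv_pos.2 hc)] at h
  rw [← smul_eq_mul, h]
  congr 1
  ext y
  simp only [indicator, mem_Ioi, mul_pos_iff_of_pos_left hc]

/-- For fixed `θ`, a point of the circle is a translate in `x` and a dilate in `y` by `1 + 3 / 4 *
sin θ`, which lies in `[1/4, 7/4]`. Translation preserves the inner norm, dilation costs at most `4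
* K`, and Minkowski moves the `θ`-integral outside both norms. -/
theorem mixedPow_circleMean_le {W : ℝ → ℝ≥0∞} (hW : Measurable W) (hWfin : ∀ y, W y ≠ ∞)
    {K : ℝ≥0∞} (hK : ∀ c y : ℝ, 1 / 4 ≤ c → c ≤ 4 → 0 < y → W y ≤ K * W (c * y))
    {p q : ℝ} (hp : 1 < p) (hq : 1 < q) {G : ℝ → ℝ → ℝ≥0∞} (hG : Measurable (Function.uncurry G)) :
    mixedPow W p q (circleMean G) ≤
      ENNReal.ofReal (2 * Real.pi) ^ q * (4 * K) * mixedPow W p q G := by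
  have hp0 : 0 < p := by linarith
  have hq0 : 0 < q := by linarith
  set M : ℝ → ℝ≥0∞ := fun y => (∫⁻ x, G x y ^ p) ^ (1 / p) with hM
  have hMm : Measurable M := (hG.pow_const p).lintegral_prod_left'.pow_const _
  set c : ℝ → ℝ := fun θ => 1 + 3 / 4 * Real.sin θ with hc
  have hcm : Measurable c := by fun_prop
  have hc1 : ∀ θ, 1 / 4 ≤ c θ := fun θ => by have := Real.neg_one_le_sin θ; simp only [hc]; linarith
  have hc4 : ∀ θ, c θ ≤ 4 := fun θ => by have := Real.sin_le_one θ; simp only [hc]; linarith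
  have hpow : ∀ a : ℝ≥0∞, a ^ (q / p) = (a ^ (1 / p)) ^ q := fun a => by
    rw [← ENNReal.rpow_mul]; congr 1; ring
  have step1 : ∀ y, (∫⁻ x, circleMean G x y ^ p) ^ (1 / p) ≤
      ∫⁻ θ in Ioc 0 (2 * Real.pi), M (c θ * y) := by
    intro y
    have hm : Measurable fun a : ℝ × ℝ =>
      (a.1 + 3 / 4 * y * Real.cos a.2, y + 3 / 4 * y * Real.sin a.2) := by fun_prop
    refine (lintegral_lintegral_rpow_le hp (μ := volume)
      (ν := volume.restrict (Ioc 0 (2 * Real.pi))) (f := fun x θ =>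
        G (x + 3 / 4 * y * Real.cos θ) (y + 3 / 4 * y * Real.sin θ)) (hG.comp hm)).trans_eq ?_
    congr 1
    ext θ
    rw [lintegral_add_right_eq_self (fun x => G x (y + 3 / 4 * y * Real.sin θ) ^ p)]
    simp only [hM, hc]
    congr! 5
    ring
  -- The weight goes into the measure, so that Minkowski with exponent `q` applies in `y`.
  set μ' := (volume.restrict (Ioi (0 : ℝ))).withDensity W with hμ'
  have : SigmaFinite μ' := SigmaFinite.withDensity_of_ne_top' hWfin
  have hN : mixedPow W p q G = ∫⁻ y in Ioi (0 : ℝ), M y ^ q * W y := by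
    unfold mixedPow; simp_rw [hpow]; rfl
  have hμint : ∀ {g : ℝ → ℝ≥0∞}, Measurable g →
      ∫⁻ y, g y ∂μ' = ∫⁻ y in Ioi (0 : ℝ), g y * W y := by
    intro g hg
    rw [hμ', lintegral_withDensity_eq_lintegral_mul _ hW hg]
    simp only [Pi.mul_apply, mul_comm]
  have step3 : ∀ θ, ∫⁻ y, M (c θ * y) ^ q ∂μ' ≤ 4 * K * mixedPow W p q G := by
    intro θ
    have hcpos : 0 < c θ := by linarith [hc1 θ]
    rw [hμint (g := fun y => M (c θ * y) ^ q)
      ((hMm.comp (measurable_const_mul _)).pow_const q), hN]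
    calc ∫⁻ y in Ioi (0 : ℝ), M (c θ * y) ^ q * W y
        ≤ ∫⁻ y in Ioi (0 : ℝ), K * (M (c θ * y) ^ q * W (c θ * y)) := by
          refine setLIntegral_mono' measurableSet_Ioi fun y hy => ?_
          rw [mul_left_comm]
          gcongr
          exact hK _ _ (hc1 θ) (hc4 θ) hy
      _ = K * (ENNReal.ofReal (c θ)⁻¹ * ∫⁻ y in Ioi (0 : ℝ), M y ^ q * W y) := by
          rw [← setLIntegral_Ioi_comp_mul_left (g := fun y => M y ^ q * W y)
            ((hMm.pow_const q).mul hW) hcpos, lintegral_const_mul]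
          exact ((hMm.pow_const q).mul hW).comp (measurable_const_mul _)
      _ ≤ K * (4 * ∫⁻ y in Ioi (0 : ℝ), M y ^ q * W y) := by
          gcongr
          rw [← ENNReal.ofReal_ofNat]
          apply ENNReal.ofReal_le_ofReal
          rw [inv_le_comm₀ hcpos (by norm_num)]
          linarith [hc1 θ]
      _ = _ := by ring
  have hMc : Measurable fun a : ℝ × ℝ => M (c a.2 * a.1) := by
    apply hMm.comp; fun_prop
  calc mixedPow W p q (circleMean G)
      ≤ ∫⁻ y in Ioi (0 : ℝ), (∫⁻ θ in Ioc 0 (2 * Real.pi), M (c θ * y)) ^ q * W y := by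
        unfold mixedPow
        simp_rw [hpow]
        gcongr with y
        exact step1 y
    _ = ∫⁻ y, (∫⁻ θ in Ioc 0 (2 * Real.pi), M (c θ * y)) ^ q ∂μ' :=
        (hμint (hMc.lintegral_prod_right'.pow_const q)).symm
    _ ≤ (∫⁻ θ in Ioc 0 (2 * Real.pi), (∫⁻ y, M (c θ * y) ^ q ∂μ') ^ (1 / q)) ^ q := by
        rw [← ENNReal.rpow_inv_le_iff hq0, ← one_div]
        exact lintegral_lintegral_rpow_le hq (f := fun y θ => M (c θ * y)) hMc
    _ ≤ (∫⁻ _ in Ioc 0 (2 * Real.pi), (4 * K * mixedPow W p q G) ^ (1 / q)) ^ q := by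
        gcongr with θ
        exact step3 θ
    _ = _ := by
        rw [setLIntegral_const, ENNReal.mul_rpow_of_nonneg _ _ hq0.le, ← ENNReal.rpow_mul,
          one_div_mul_cancel hq0.ne', ENNReal.rpow_one, Real.volume_Ioc, sub_zero]
        ring

/-! ### The oscillation of a holomorphic function -/

/-- The modulus of `F` on the upper half-plane, extended by zero. -/
def upperModulus (F : ℂ → ℂ) (x y : ℝ) : ℝ≥0∞ :=
  {y : ℝ | 0 < y}.indicator (fun y : ℝ => ‖F ((x : ℂ) + (y : ℂ) * Complex.I)‖ₑ) y

theorem upperModulus_of_pos (F : ℂ → ℂ) (x : ℝ) {y : ℝ} (hy : 0 < y) :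
    upperModulus F x y = ‖F ((x : ℂ) + (y : ℂ) * Complex.I)‖ₑ := by
  simp [upperModulus, hy]

theorem measurable_upperModulus {F : ℂ → ℂ} (hF : ContinuousOn F {z : ℂ | 0 < z.im}) :
    Measurable (Function.uncurry (upperModulus F)) := by
  have hs : MeasurableSet {a : ℝ × ℝ | 0 < a.2} := measurableSet_lt measurable_const measurable_snd
  have : Function.uncurry (upperModulus F) = {a : ℝ × ℝ | 0 < a.2}.piecewise
      (fun a => ‖F ((a.1 : ℂ) + (a.2 : ℂ) * Complex.I)‖ₑ) 0 := by
    ext a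
    by_cases h : 0 < a.2 <;> simp [upperModulus, Set.piecewise, h, Function.uncurry]
  rw [this]
  refine ContinuousOn.measurable_piecewise ?_ continuousOn_const hs
  refine ContinuousOn.enorm (hF.comp (by fun_prop) ?_)
  intro a ha
  simpa using ha

/-- The difference of the Cauchy kernels at `z` and `w` is `(z - w) / ((ζ - z) * (ζ - w))`. The
factor `|ζ - z| = R` cancels against the arc length, and `|ζ - w| ≥ 3 y / 4 - 5 y / 8 = y / 8`
produces the 8. -/
theorem enorm_sub_le_circleMean {F : ℂ → ℂ} (hF : DifferentiableOn ℂ F {z : ℂ | 0 < z.im})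
    {x y ε : ℝ} (hy : 0 < y) (hε : ε ≤ 5 / 8) {w : ℂ}
    (hw : ‖((x : ℂ) + (y : ℂ) * Complex.I) - w‖ ≤ ε * y) :
    ‖F ((x : ℂ) + (y : ℂ) * Complex.I) - F w‖ₑ ≤
      ENNReal.ofReal (8 * ε) * circleMean (upperModulus F) x y := by
  set z : ℂ := (x : ℂ) + (y : ℂ) * Complex.I with hz
  set R : ℝ := 3 / 4 * y with hR
  have hR0 : 0 < R := by positivity
  have hε0 : 0 ≤ ε := nonneg_of_mul_nonneg_left ((norm_nonneg _).trans hw) hy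
  have hwR : ‖z - w‖ ≤ 5 / 8 * y := hw.trans (by gcongr)
  have hball : Metric.closedBall z R ⊆ {z : ℂ | 0 < z.im} := by
    intro ζ hζ
    have h1 : |(ζ - z).im| ≤ R := (Complex.abs_im_le_norm _).trans (by simpa [dist_eq_norm] using hζ)
    have h2 := (abs_le.1 h1).1
    have h3 : (ζ - z).im = ζ.im - y := by simp [hz]
    simp only [mem_ofPred_eq]
    rw [h3] at h2
    linarith
  have hC : ContinuousOn F (Metric.closedBall z R) := hF.continuousOn.mono hball
  have hopen : IsOpen {z : ℂ | 0 < z.im} := isOpen_lt continuous_const Complex.continuous_im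
  have hcif : ∀ u ∈ Metric.ball z R,
      (∮ ζ in C(z, R), (ζ - u)⁻¹ • F ζ) = (2 * Real.pi * Complex.I : ℂ) • F u := fun u hu =>
    Complex.circleIntegral_sub_inv_smul_of_differentiable_on_off_countable countable_empty hu hC
      fun v hv => hF.differentiableAt
        (hopen.mem_nhds (hball (Metric.ball_subset_closedBall hv.1)))
  have hwb : w ∈ Metric.ball z R := by
    rw [Metric.mem_ball', dist_eq_norm]; linarith
  have hzb : z ∈ Metric.ball z R := Metric.mem_ball_self hR0
  have hint : ∀ u ∈ Metric.ball z R, CircleIntegrable (fun ζ => (ζ - u)⁻¹ • F ζ) z R := by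
    intro u hu
    refine ContinuousOn.circleIntegrable hR0.le (ContinuousOn.fun_smul ?_ (hC.mono
      Metric.sphere_subset_closedBall))
    refine ContinuousOn.inv₀ (by fun_prop) fun ζ hζ h => ?_
    rw [sub_eq_zero.1 h] at hζ
    rw [Metric.mem_sphere] at hζ
    rw [Metric.mem_ball] at hu
    linarith
  have heq : (2 * Real.pi * Complex.I : ℂ) • (F z - F w) =
      ∮ ζ in C(z, R), ((ζ - z)⁻¹ • F ζ - (ζ - w)⁻¹ • F ζ) := by
    rw [circleIntegral.integral_sub (hint z hzb) (hint w hwb), hcif z hzb, hcif w hwb, smul_sub]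
  -- The gain `1 / (2 π)` in Cauchy's formula is simply discarded.
  have hle : ‖F z - F w‖ₑ ≤ ‖(2 * Real.pi * Complex.I : ℂ) • (F z - F w)‖ₑ := by
    rw [enorm_le_iff_norm_le, norm_smul]
    refine le_mul_of_one_le_left (norm_nonneg _) ?_
    have : ‖(2 * Real.pi * Complex.I : ℂ)‖ = 2 * Real.pi := by
      simp [Real.pi_pos.le]
    rw [this]
    linarith [Real.pi_gt_three]
  refine hle.trans ?_
  rw [heq, circleIntegral, intervalIntegral.integral_of_le (by positivity)]
  refine (enorm_integral_le_lintegral_enorm _).trans ?_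
  rw [circleMean, ← lintegral_const_mul' _ _ ENNReal.ofReal_ne_top]
  refine lintegral_mono fun θ => ?_
  have hpt : circleMap z R θ = ((x + 3 / 4 * y * Real.cos θ : ℝ) : ℂ) +
      ((y + 3 / 4 * y * Real.sin θ : ℝ) : ℂ) * Complex.I := by
    rw [circleMap, Complex.exp_mul_I, hz, hR]
    push_cast
    ring
  have hypos : 0 < y + 3 / 4 * y * Real.sin θ := by
    nlinarith [Real.neg_one_le_sin θ]
  rw [upperModulus_of_pos _ _ hypos, ← hpt]
  set ζ := circleMap z R θ with hζ
  have hζz : ‖ζ - z‖ = R := by simp [hζ, circleMap, abs_of_pos hR0]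
  have hζw : y / 8 ≤ ‖ζ - w‖ := by
    have : ‖ζ - z‖ ≤ ‖ζ - w‖ + ‖z - w‖ := by
      have := norm_sub_le (ζ - w) (z - w)
      simpa using this
    rw [hζz] at this
    linarith
  have hne : ζ - z ≠ 0 := by rw [← norm_pos_iff, hζz]; exact hR0
  have hne' : ζ - w ≠ 0 := by rw [← norm_pos_iff]; linarith
  have hkey : ‖deriv (circleMap z R) θ • ((ζ - z)⁻¹ • F ζ - (ζ - w)⁻¹ • F ζ)‖ ≤
      8 * ε * ‖F ζ‖ := by
    rw [← sub_smul, norm_smul, norm_smul, inv_sub_inv hne hne', sub_sub_sub_cancel_left,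
      norm_div, norm_mul, hζz, ← mul_assoc]
    have hd : ‖deriv (circleMap z R) θ‖ = R := by simp [abs_of_pos hR0]
    rw [hd]
    have hpos : 0 < ‖ζ - w‖ := by linarith
    refine mul_le_mul_of_nonneg_right ?_ (norm_nonneg _)
    rw [mul_div_assoc', mul_div_mul_left _ _ hR0.ne', div_le_iff₀ hpos]
    calc ‖z - w‖ ≤ 8 * ε * (y / 8) := hw.trans_eq (by ring)
      _ ≤ _ := by gcongr
  rw [← ofReal_norm, ← ofReal_norm, ← ENNReal.ofReal_mul (by positivity)]
  exact ENNReal.ofReal_le_ofReal hkey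

/-! ### The weights -/

/-- On `classL` doubling follows from the monotonicity of `Φ t / t`, on `classU` from the upper
type. -/
theorem exists_doubling {Φ : ℝ≥0 → ℝ≥0} (hΦ : Φ ∈ classL ∪ classU) :
    ∃ K : ℝ≥0, ∀ t : ℝ≥0, 0 < t → Φ (4 * t) ≤ K * Φ t := by
  rcases hΦ with ⟨r, -, -, -, -, h⟩ | ⟨r, -, -, ⟨C, -, hC⟩, -⟩
  · refine ⟨4, fun t ht => ?_⟩
    have h4 : (0 : ℝ≥0) < 4 * t := by positivity
    have := h (mem_Ioi.2 ht) (mem_Ioi.2 h4) (le_mul_of_one_le_left zero_le (by norm_num))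
    simp only at this
    rw [div_le_div_iff₀ h4 ht] at this
    refine le_of_mul_le_mul_right (this.trans_eq ?_) ht
    ring
  · refine ⟨C * 4 ^ r, fun t ht => ?_⟩
    rw [mul_comm 4 t]
    exact hC 4 (by norm_num) t ht

theorem continuous_of_mem {Φ : ℝ≥0 → ℝ≥0} (hΦ : Φ ∈ classL ∪ classU) : Continuous Φ := by
  rcases hΦ with ⟨r, -, -, h, -⟩ | ⟨r, -, h, -⟩ <;> exact h.continuous

theorem monotone_of_mem {Φ : ℝ≥0 → ℝ≥0} (hΦ : Φ ∈ classL ∪ classU) : Monotone Φ := by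
  rcases hΦ with ⟨r, -, -, h, -⟩ | ⟨r, -, h, -⟩ <;> exact h.monotone

theorem measurable_growthWeight {Φ : ℝ≥0 → ℝ≥0} (hΦ : Φ ∈ classL ∪ classU) (ε₁ ε₂ : ℝ) :
    Measurable (growthWeight Φ ε₁ ε₂) := by
  have h := (continuous_of_mem hΦ).measurable
  have hl : Measurable Real.posLog := by
    rw [Real.posLog_def]; exact measurable_const.max Real.measurable_log
  unfold growthWeight
  refine ((measurable_const.add ((hl.comp ?_).const_mul _))).add ((hl.comp ?_).const_mul _)
  · exact (h.comp ((measurable_const.div measurable_id).real_toNNReal)).coe_nnreal_real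
  · exact (h.comp measurable_id.real_toNNReal).coe_nnreal_real

theorem one_le_growthWeight (Φ : ℝ≥0 → ℝ≥0) {ε₁ ε₂ : ℝ} (h₁ : 0 ≤ ε₁) (h₂ : 0 ≤ ε₂) (t : ℝ) :
    1 ≤ growthWeight Φ ε₁ ε₂ t := by
  have a := mul_nonneg h₁ (Real.posLog_nonneg (x := (Φ (1 / t).toNNReal : ℝ)))
  have b := mul_nonneg h₂ (Real.posLog_nonneg (x := (Φ t.toNNReal : ℝ)))
  unfold growthWeight
  linarith

/-- Under `posLog` a doubling constant becomes an additive one, which a weight bounded below by 1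
absorbs. The two-sided condition on `s`, `t` is stable under inversion, which handles the term in `1
/ t`. -/
theorem exists_growthWeight_le {Φ : ℝ≥0 → ℝ≥0} (hΦ : Φ ∈ classL ∪ classU) {ε₁ ε₂ : ℝ}
    (h₁ : 0 ≤ ε₁) (h₂ : 0 ≤ ε₂) :
    ∃ K : ℝ, 1 ≤ K ∧ ∀ s t : ℝ, 0 < s → 0 < t → s ≤ 4 * t → t ≤ 4 * s →
      growthWeight Φ ε₁ ε₂ s ≤ K * growthWeight Φ ε₁ ε₂ t := by
  obtain ⟨K, hK⟩ := exists_doubling hΦ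
  have key : ∀ s t : ℝ, 0 < s → 0 < t → s ≤ 4 * t →
      Real.posLog (Φ s.toNNReal : ℝ) ≤ Real.posLog K + Real.posLog (Φ t.toNNReal : ℝ) := by
    intro s t hs ht hst
    refine le_trans (Real.posLog_le_posLog (NNReal.coe_nonneg _) ?_) Real.posLog_mul
    have h := hK t.toNNReal (Real.toNNReal_pos.2 ht)
    have h' : s.toNNReal ≤ 4 * t.toNNReal := by
      rw [← NNReal.coe_le_coe]
      simpa [Real.coe_toNNReal _ hs.le, Real.coe_toNNReal _ ht.le] using hst
    exact_mod_cast (monotone_of_mem hΦ h').trans h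
  set L := Real.posLog (K : ℝ)
  have hL : 0 ≤ L := Real.posLog_nonneg
  refine ⟨1 + ε₁ * L + ε₂ * L, by nlinarith [mul_nonneg h₁ hL, mul_nonneg h₂ hL],
    fun s t hs ht hst hts => ?_⟩
  have e1 := key (1 / s) (1 / t) (by positivity) (by positivity) (by
    rw [mul_one_div, div_le_div_iff₀ hs ht]; linarith)
  have e2 := key s t hs ht hst
  have g1 := one_le_growthWeight Φ h₁ h₂ t
  have : growthWeight Φ ε₁ ε₂ s ≤ growthWeight Φ ε₁ ε₂ t + (ε₁ * L + ε₂ * L) := by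
    unfold growthWeight
    linarith [mul_le_mul_of_nonneg_left e1 h₁, mul_le_mul_of_nonneg_left e2 h₂]
  nlinarith [mul_nonneg h₁ hL, mul_nonneg h₂ hL]

theorem rpow_le_rpow_abs_mul {a b K : ℝ} (ha : 0 < a) (hb : 0 < b) (hK : 1 ≤ K)
    (hab : a ≤ K * b) (hba : b ≤ K * a) (k : ℝ) : a ^ k ≤ K ^ |k| * b ^ k := by
  have hK0 : 0 < K := by linarith
  rcases le_total 0 k with hk | hk
  · rw [abs_of_nonneg hk, ← Real.mul_rpow hK0.le hb.le]
    exact Real.rpow_le_rpow ha.le hab hk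
  · rw [abs_of_nonpos hk, Real.rpow_neg hK0.le, ← Real.inv_rpow hK0.le,
      ← Real.mul_rpow (by positivity) hb.le]
    refine Real.rpow_le_rpow_of_nonpos (by positivity) ?_ hk
    rwa [inv_mul_le_iff₀ hK0]

/-- The density `w` is comparable at points of comparable size. -/
structure IsModerateWeight (K : ℝ) (w : ℝ → ℝ) : Prop where
  measurable : Measurable w
  pos : ∀ t, 0 < t → 0 < w t
  one_le : 1 ≤ K
  le : ∀ s t : ℝ, 0 < s → 0 < t → s ≤ 4 * t → t ≤ 4 * s → w s ≤ K * w t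

theorem exists_isModerateWeight {Φ : ℝ≥0 → ℝ≥0} (hΦ : Φ ∈ classL ∪ classU) {ε₁ ε₂ : ℝ}
    (h₁ : 0 ≤ ε₁) (h₂ : 0 ≤ ε₂) (k α : ℝ) :
    ∃ K : ℝ, IsModerateWeight K fun t => growthWeight Φ ε₁ ε₂ t ^ k * t ^ α := by
  obtain ⟨K, hK1, hK⟩ := exists_growthWeight_le hΦ h₁ h₂
  have hpos : ∀ t, 0 < growthWeight Φ ε₁ ε₂ t := fun t =>
    one_pos.trans_le (one_le_growthWeight Φ h₁ h₂ t)
  refine ⟨K ^ |k| * 4 ^ |α|, ⟨?_, fun t ht => ?_, ?_, fun s t hs ht hst hts => ?_⟩⟩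
  · exact ((measurable_growthWeight hΦ ε₁ ε₂).pow_const k).mul (measurable_id.pow_const α)
  · exact mul_pos (Real.rpow_pos_of_pos (hpos t) _) (Real.rpow_pos_of_pos ht _)
  · exact one_le_mul_of_one_le_of_one_le (Real.one_le_rpow hK1 (abs_nonneg _))
      (Real.one_le_rpow (by norm_num) (abs_nonneg _))
  · rw [mul_mul_mul_comm]
    gcongr
    · exact mul_nonneg (Real.rpow_nonneg (by linarith) _) (Real.rpow_nonneg (hpos t).le _)
    · exact rpow_le_rpow_abs_mul (hpos s) (hpos t) hK1 (hK s t hs ht hst hts)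
        (hK t s ht hs hts hst) k
    · exact rpow_le_rpow_abs_mul hs ht (by norm_num) hst hts α

/-! ### The lattice -/

/-- With `b = 2 ^ γ`, the condition on `γ` bounds `b ^ 4` on both sides in terms of `δ` alone; this
is why later constants do not depend on `γ`. -/
theorem IsLatticeExponent.bounds {δ γ : ℝ} (hδ : 0 < δ) (hδ1 : δ < 1)
    (h : IsLatticeExponent δ γ) :
    0 < γ ∧ δ ^ 2 / 150 ≤ (2 : ℝ) ^ γ - 1 ∧ (2 : ℝ) ^ γ ≤ 2 ∧
      (2 : ℝ) ^ γ - 1 ≤ δ ^ 2 / 2 * (2 : ℝ) ^ γ := by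
  obtain ⟨h1, h2⟩ := h
  have hlog : 0 < Real.log 2 := Real.log_pos (by norm_num)
  have hd0 : 0 < δ ^ 2 := by positivity
  have hd1 : δ ^ 2 < 1 := by nlinarith
  have hR0 : 1 + δ ^ 2 / 10 ≤ (1 + δ ^ 2 / 20) / (1 - δ ^ 2 / 20) := by
    rw [le_div_iff₀ (by linarith)]; nlinarith
  have hγ : 0 < γ := by
    refine lt_of_le_of_lt (div_nonneg (Real.log_nonneg ?_) (by positivity)) h1
    linarith
  set b : ℝ := (2 : ℝ) ^ γ with hb
  have hb1 : 1 < b := Real.one_lt_rpow (by norm_num) hγ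
  have hb0 : 0 < b := by linarith
  have hb4 : Real.log (b ^ 4) = γ * (4 * Real.log 2) := by
    rw [Real.log_pow, hb, Real.log_rpow (by norm_num)]; push_cast; ring
  rw [div_lt_iff₀ (by positivity), ← hb4] at h1
  rw [lt_div_iff₀ (by positivity), ← hb4] at h2
  have k1 := (Real.log_lt_log_iff (by linarith) (by positivity)).1 h1
  have k2 := (Real.log_lt_log_iff (by positivity)
    (div_pos (by linarith) (by linarith))).1 h2
  have hbb : b ≤ b ^ 4 := le_self_pow₀ hb1.le (by norm_num)
  have k3 : b * (1 - δ ^ 2 / 4) < 1 + δ ^ 2 / 4 := by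
    rw [← lt_div_iff₀ (by linarith)]; linarith
  have hb2 : b ≤ 2 := by nlinarith
  refine ⟨hγ, ?_, hb2, by nlinarith⟩
  -- Here `15 = 8 + 4 + 2 + 1`, from `b ≤ 2`; combined with `b ^ 4 - 1 ≥ δ ^ 2 / 10` it gives the
  -- 150.
  have hfac : b ^ 4 - 1 ≤ 15 * (b - 1) := by
    have e : b ^ 4 - 1 = (b - 1) * (b ^ 3 + b ^ 2 + b + 1) := by ring
    have c3 : b ^ 3 ≤ 2 ^ 3 := by gcongr
    have c2 : b ^ 2 ≤ 2 ^ 2 := by gcongr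
    rw [e, mul_comm 15]
    gcongr
    linarith
  linarith

/-- The index `j` of the layer `2 ^ (γ j) ≤ y < 2 ^ (γ (j + 1))` that contains `y`. -/
def layer (γ y : ℝ) : ℤ := ⌊Real.logb 2 y / γ⌋

/-- The horizontal spacing of the `j`-th layer of the `δ`-lattice. -/
def spacing (δ γ : ℝ) (j : ℤ) : ℝ := δ ^ 2 / 8 * (2 : ℝ) ^ (γ * (j : ℝ))

/-- The lattice point that is the lower left corner of the cell that contains `x + i y`. -/
def corner (δ γ x y : ℝ) : ℂ :=
  latticePoint δ γ ⌊x / spacing δ γ (layer γ y)⌋ (layer γ y)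

theorem spacing_pos {δ : ℝ} (hδ : 0 < δ) (γ : ℝ) (j : ℤ) : 0 < spacing δ γ j := by
  unfold spacing; positivity

theorem latticePoint_eq (δ γ : ℝ) (l j : ℤ) : latticePoint δ γ l j =
    ((spacing δ γ j * l : ℝ) : ℂ) + (((2 : ℝ) ^ (γ * (j : ℝ)) : ℝ) : ℂ) * Complex.I := by
  unfold latticePoint spacing
  congr 2
  rw [Real.rpow_sub (by norm_num), Real.rpow_one]
  ring

theorem layer_eq_iff {γ y : ℝ} (hγ : 0 < γ) (hy : 0 < y) (j : ℤ) :
    layer γ y = j ↔ (2 : ℝ) ^ (γ * (j : ℝ)) ≤ y ∧ y < (2 : ℝ) ^ γ * (2 : ℝ) ^ (γ * (j : ℝ)) := by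
  rw [layer, Int.floor_eq_iff, le_div_iff₀ hγ, div_lt_iff₀ hγ, Real.le_logb_iff_rpow_le
    (by norm_num) hy, Real.logb_lt_iff_lt_rpow (by norm_num) hy, ← Real.rpow_add (by norm_num)]
  ring_nf

theorem measurable_layer (γ : ℝ) : Measurable (layer γ) := by
  unfold layer
  exact Int.measurable_floor.comp ((Real.measurable_log.div_const _).div_const _)

/-- The horizontal offset contributes `1 / 8` and the vertical one `1 / 2`. -/
theorem norm_sub_corner_le {δ γ : ℝ} (hδ : 0 < δ) (hδ1 : δ < 1) (h : IsLatticeExponent δ γ)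
    (x : ℝ) {y : ℝ} (hy : 0 < y) :
    ‖((x : ℂ) + (y : ℂ) * Complex.I) - corner δ γ x y‖ ≤ 5 / 8 * δ ^ 2 * y := by
  obtain ⟨hγ, -, -, hb⟩ := h.bounds hδ hδ1
  set j := layer γ y with hj
  obtain ⟨h1, h2⟩ := (layer_eq_iff hγ hy j).1 hj.symm
  set t := (2 : ℝ) ^ (γ * (j : ℝ)) with ht
  have ht0 : 0 < t := by positivity
  have hs0 := spacing_pos hδ γ j
  set s := spacing δ γ j with hs
  set l := ⌊x / s⌋ with hl
  have e : ((x : ℂ) + (y : ℂ) * Complex.I) - corner δ γ x y =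
      ((x - s * l : ℝ) : ℂ) + ((y - t : ℝ) : ℂ) * Complex.I := by
    rw [corner, latticePoint_eq]
    push_cast
    ring
  rw [e]
  have hx1 : s * l ≤ x := by rw [mul_comm, ← le_div_iff₀ hs0]; exact Int.floor_le _
  have hx2 : x < s * l + s := by
    have := Int.lt_floor_add_one (x / s)
    rw [div_lt_iff₀ hs0] at this
    linarith
  have hst : s ≤ δ ^ 2 / 8 * y := by rw [hs, spacing]; gcongr
  have hyt : y - t ≤ δ ^ 2 / 2 * y := by
    have hB : (1 : ℝ) < 2 ^ γ := Real.one_lt_rpow (by norm_num) hγ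
    have : (2 : ℝ) ^ γ * (y - t) ≤ (2 : ℝ) ^ γ * (δ ^ 2 / 2 * y) := by nlinarith
    exact le_of_mul_le_mul_left this (by linarith)
  refine (norm_add_le _ _).trans ?_
  rw [norm_mul, Complex.norm_I, mul_one, Complex.norm_real, Complex.norm_real, Real.norm_of_nonneg
    (by linarith), Real.norm_of_nonneg (by linarith)]
  linarith

/-! ### The discrete norm as the mixed norm of a step function -/

theorem lintegral_eq_tsum_fiber {X : Type*} [MeasurableSpace X] (μ : Measure X) {T : X → ℤ}
    (hT : Measurable T) (f : X → ℝ≥0∞) :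
    ∫⁻ x, f x ∂μ = ∑' j : ℤ, ∫⁻ x in T ⁻¹' {j}, f x ∂μ := by
  rw [← lintegral_iUnion (fun j => hT (measurableSet_singleton j))
    (fun i j hij => Disjoint.preimage T (disjoint_singleton.2 hij)), ← preimage_iUnion,
    iUnion_of_singleton, preimage_univ, setLIntegral_univ]

theorem lintegral_comp_floor_div (g : ℤ → ℝ≥0∞) {h : ℝ} (hh : 0 < h) :
    ∫⁻ x : ℝ, g ⌊x / h⌋ = ENNReal.ofReal h * ∑' l : ℤ, g l := by
  have hT : Measurable fun x : ℝ => ⌊x / h⌋ := Int.measurable_floor.comp (measurable_id.div_const h)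
  rw [lintegral_eq_tsum_fiber _ hT, ← ENNReal.tsum_mul_left]
  congr 1
  ext l
  have e : (fun x : ℝ => ⌊x / h⌋) ⁻¹' {l} = Ico (l * h) ((l + 1) * h) := by
    ext x
    simp [Int.floor_eq_iff, le_div_iff₀ hh, div_lt_iff₀ hh]
  rw [setLIntegral_congr_fun (g := fun _ => g l) (hT (measurableSet_singleton l))
    (fun x hx => by simpa using congrArg g hx), setLIntegral_const, e, Real.volume_Ico, mul_comm]
  congr 2
  ring

/-- Within a layer the step function depends only on `⌊x / spacing⌋`, so the inner integral is the
spacing times the sum over `l`, and only the weight still varies with `y`. -/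
theorem mixedPow_corner {δ : ℝ} (hδ : 0 < δ) (γ : ℝ) {W : ℝ → ℝ≥0∞} {p q : ℝ}
    (hp : 0 < p) (hq : 0 < q) (F : ℂ → ℂ) (hW : Measurable W) :
    mixedPow W p q (fun x y => ‖F (corner δ γ x y)‖ₑ) =
      ∑' j : ℤ, (∑' l : ℤ, ‖F (latticePoint δ γ l j)‖ₑ ^ p) ^ (q / p) *
        (ENNReal.ofReal (spacing δ γ j ^ (q / p)) *
          ∫⁻ y in layer γ ⁻¹' {j} ∩ Ioi 0, W y) := by
  unfold mixedPow
  rw [lintegral_eq_tsum_fiber _ (measurable_layer γ)]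
  congr 1
  ext j
  have hm : MeasurableSet (layer γ ⁻¹' {j}) := measurable_layer γ (measurableSet_singleton j)
  rw [Measure.restrict_restrict hm, ← mul_assoc, ← lintegral_const_mul _ hW]
  refine setLIntegral_congr_fun (hm.inter measurableSet_Ioi) fun y hy => ?_
  have hj : layer γ y = j := hy.1
  simp only [corner, hj]
  rw [lintegral_comp_floor_div (fun l => ‖F (latticePoint δ γ l j)‖ₑ ^ p) (spacing_pos hδ γ j),
    ENNReal.mul_rpow_of_nonneg _ _ (by positivity),
    ENNReal.ofReal_rpow_of_nonneg (spacing_pos hδ γ j).le (by positivity)]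
  congr 1
  rw [mul_comm]

theorem layer_fiber {γ : ℝ} (hγ : 0 < γ) (j : ℤ) : layer γ ⁻¹' {j} ∩ Ioi 0 =
    Ico ((2 : ℝ) ^ (γ * (j : ℝ))) ((2 : ℝ) ^ γ * (2 : ℝ) ^ (γ * (j : ℝ))) := by
  ext y
  simp only [mem_inter_iff, mem_preimage, mem_singleton_iff, mem_Ioi, mem_Ico]
  constructor
  · rintro ⟨h, hy⟩
    exact (layer_eq_iff hγ hy j).1 h
  · intro h
    have hy : 0 < y := lt_of_lt_of_le (by positivity) h.1
    exact ⟨(layer_eq_iff hγ hy j).2 h, hy⟩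

theorem lintegral_layer_bounds {δ γ : ℝ} (hδ : 0 < δ) (hδ1 : δ < 1) (h : IsLatticeExponent δ γ)
    {K : ℝ} {w : ℝ → ℝ} (hw : IsModerateWeight K w) (j : ℤ) {t : ℝ}
    (ht : t = (2 : ℝ) ^ (γ * (j : ℝ))) :
    ∫⁻ y in layer γ ⁻¹' {j} ∩ Ioi 0, ENNReal.ofReal (w y) ≤ ENNReal.ofReal (K * (w t * t)) ∧
    ENNReal.ofReal (w t * t) ≤ ENNReal.ofReal (K * (150 / δ ^ 2)) *
      ∫⁻ y in layer γ ⁻¹' {j} ∩ Ioi 0, ENNReal.ofReal (w y) := by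
  obtain ⟨hγ, hb1, hb2, -⟩ := h.bounds hδ hδ1
  rw [layer_fiber hγ, ← ht]
  have ht0 : 0 < t := by rw [ht]; positivity
  have hK := hw.one_le
  have hwt := hw.pos t ht0
  set b := (2 : ℝ) ^ γ
  have hbt : b * t ≤ 2 * t := by gcongr
  have hd0 : 0 < δ ^ 2 := by positivity
  constructor
  · calc ∫⁻ y in Ico t (b * t), ENNReal.ofReal (w y)
        ≤ ∫⁻ _ in Ico t (b * t), ENNReal.ofReal (K * w t) := by
          refine setLIntegral_mono' measurableSet_Ico fun y hy => ENNReal.ofReal_le_ofReal ?_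
          have h1 := hy.1
          have h2 := hy.2
          exact hw.le y t (by linarith) ht0 (by linarith) (by linarith)
      _ ≤ _ := by
          rw [setLIntegral_const, Real.volume_Ico, ← ENNReal.ofReal_mul (by positivity), ← mul_assoc]
          gcongr
          linarith
  · calc ENNReal.ofReal (w t * t)
        ≤ ENNReal.ofReal (K * (150 / δ ^ 2)) *
            ∫⁻ _ in Ico t (b * t), ENNReal.ofReal (w t / K) := by
          rw [setLIntegral_const, Real.volume_Ico, ← ENNReal.ofReal_mul (by positivity),
            ← ENNReal.ofReal_mul (by positivity)]
          refine ENNReal.ofReal_le_ofReal ?_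
          have e : K * (150 / δ ^ 2) * (w t / K * (b * t - t)) =
              w t * t * ((b - 1) / (δ ^ 2 / 150)) := by
            field_simp
          rw [e]
          refine le_mul_of_one_le_right (by positivity) ?_
          rwa [one_le_div (by positivity)]
      _ ≤ _ := by
          refine mul_le_mul' le_rfl
            (setLIntegral_mono' measurableSet_Ico fun y hy => ENNReal.ofReal_le_ofReal ?_)
          have h1 := hy.1
          have h2 := hy.2
          rw [div_le_iff₀' (by linarith)]
          exact hw.le t y ht0 (by linarith) (by linarith) (by linarith)

theorem discrete_bounds {δ γ : ℝ} (hδ : 0 < δ) (hδ1 : δ < 1) (h : IsLatticeExponent δ γ)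
    {K α p q : ℝ} {Ω : ℝ → ℝ} (hw : IsModerateWeight K fun t => Ω t * t ^ α)
    (hp : 0 < p) (hq : 0 < q) (F : ℂ → ℂ) :
    mixedPow (fun y => ENNReal.ofReal (Ω y * y ^ α)) p q (fun x y => ‖F (corner δ γ x y)‖ₑ) ≤
      ENNReal.ofReal ((δ ^ 2 / 8) ^ (q / p) * K) * discreteNormPow Ω α p q δ γ F ∧
    discreteNormPow Ω α p q δ γ F ≤
      ENNReal.ofReal (((δ ^ 2 / 8) ^ (q / p))⁻¹ * (K * (150 / δ ^ 2))) *
        mixedPow (fun y => ENNReal.ofReal (Ω y * y ^ α)) p q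
          (fun x y => ‖F (corner δ γ x y)‖ₑ) := by
  have hK : 0 ≤ K := by linarith [hw.one_le]
  rw [mixedPow_corner hδ γ hp hq F hw.measurable.ennreal_ofReal]
  unfold discreteNormPow
  rw [← ENNReal.tsum_mul_left, ← ENNReal.tsum_mul_left]
  -- In the exponent, `α` belongs to the weight, `1` to the thickness of the layer and `q / p` to
  -- the horizontal spacing.
  have hD : ∀ j : ℤ, Ω ((2 : ℝ) ^ (γ * (j : ℝ))) * (2 : ℝ) ^ (γ * (j : ℝ) * (α + 1 + q / p)) =
      (Ω ((2 : ℝ) ^ (γ * (j : ℝ))) * ((2 : ℝ) ^ (γ * (j : ℝ))) ^ α * (2 : ℝ) ^ (γ * (j : ℝ))) *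
        ((2 : ℝ) ^ (γ * (j : ℝ))) ^ (q / p) := by
    intro j
    rw [Real.rpow_mul zero_le_two (γ * (j : ℝ)) (α + 1 + q / p), Real.rpow_add (by positivity),
      Real.rpow_add (by positivity), Real.rpow_one]
    ring
  have hS : ∀ j : ℤ, spacing δ γ j ^ (q / p) =
      (δ ^ 2 / 8) ^ (q / p) * ((2 : ℝ) ^ (γ * (j : ℝ))) ^ (q / p) := fun j =>
    Real.mul_rpow (by positivity) (by positivity)
  have hc : 0 < (δ ^ 2 / 8) ^ (q / p) := by positivity
  constructor
  · refine ENNReal.tsum_le_tsum fun j => ?_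
    have hL := (lintegral_layer_bounds hδ hδ1 h hw j rfl).1
    refine (mul_le_mul' le_rfl ?_).trans_eq (mul_left_comm _ _ _)
    rw [hD, hS]
    set t := (2 : ℝ) ^ (γ * (j : ℝ))
    have ht0 : 0 < t := by positivity
    have ht : 0 < t ^ (q / p) := by positivity
    calc _ ≤ ENNReal.ofReal ((δ ^ 2 / 8) ^ (q / p) * t ^ (q / p)) *
          ENNReal.ofReal (K * (Ω t * t ^ α * t)) := by gcongr
      _ = _ := by
        rw [← ENNReal.ofReal_mul (by positivity), ← ENNReal.ofReal_mul (by positivity)]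
        congr 1
        ring
  · refine ENNReal.tsum_le_tsum fun j => ?_
    have hL := (lintegral_layer_bounds hδ hδ1 h hw j rfl).2
    refine (mul_le_mul' le_rfl ?_).trans_eq (mul_left_comm _ _ _)
    rw [hD, hS]
    set t := (2 : ℝ) ^ (γ * (j : ℝ))
    have ht0 : 0 < t := by positivity
    have ht : 0 < t ^ (q / p) := by positivity
    have hwt := (hw.pos t ht0).le
    rw [ENNReal.ofReal_mul (mul_nonneg hwt ht0.le)]
    calc _ ≤ ENNReal.ofReal (K * (150 / δ ^ 2)) *
          (∫⁻ y in layer γ ⁻¹' {j} ∩ Ioi 0, ENNReal.ofReal (Ω y * y ^ α)) *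
            ENNReal.ofReal (t ^ (q / p)) := by gcongr
      _ = _ := by
        rw [mul_right_comm, ← mul_assoc, ← ENNReal.ofReal_mul (by positivity),
          ← ENNReal.ofReal_mul (by positivity)]
        congr 2
        field_simp

/-! ### Comparison of a function with its step function -/

/-- `E` is chosen before `δ`, so the factor `(5 * δ ^ 2) ^ q` makes the error small relative to it.
-/
theorem exists_mixedPow_comparison {K : ℝ} {w : ℝ → ℝ} (hw : IsModerateWeight K w) {p q : ℝ}
    (hp : 1 < p) (hq : 1 < q) :
    ∃ E : ℝ, 0 < E ∧ ∀ δ γ : ℝ, 0 < δ → δ < 1 → IsLatticeExponent δ γ → ∀ F : ℂ → ℂ,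
      DifferentiableOn ℂ F {z : ℂ | 0 < z.im} →
      ∀ N S : ℝ≥0∞, N = mixedPow (fun y => ENNReal.ofReal (w y)) p q
          (fun x y => ‖F ((x : ℂ) + (y : ℂ) * Complex.I)‖ₑ) →
        S = mixedPow (fun y => ENNReal.ofReal (w y)) p q (fun x y => ‖F (corner δ γ x y)‖ₑ) →
        S ≤ ENNReal.ofReal E * (N + ENNReal.ofReal ((5 * δ ^ 2) ^ q) * N) ∧
        N ≤ ENNReal.ofReal E * (S + ENNReal.ofReal ((5 * δ ^ 2) ^ q) * N) := by
  have hp0 : 0 < p := by linarith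
  have hq0 : 0 < q := by linarith
  have hK := hw.one_le
  set W : ℝ → ℝ≥0∞ := fun y => ENNReal.ofReal (w y) with hWdef
  have hW : Measurable W := hw.measurable.ennreal_ofReal
  set B : ℝ := 2 ^ q * 2 ^ (q / p) with hB
  -- The maximum with 1 lets the same constant multiply the main term and the error.
  set D : ℝ := max 1 ((2 * Real.pi) ^ q * (4 * K)) with hD
  have hB0 : 0 < B := by positivity
  have hD1 : 1 ≤ D := le_max_left _ _
  have hBeq : (2 : ℝ≥0∞) ^ q * 2 ^ (q / p) = ENNReal.ofReal B := by
    rw [hB, ENNReal.ofReal_mul (by positivity), ← ENNReal.ofReal_rpow_of_pos two_pos,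
      ← ENNReal.ofReal_rpow_of_pos two_pos, ENNReal.ofReal_ofNat]
  refine ⟨B * D, by positivity, fun δ γ hδ hδ1 hγ F hF N S hN hS => ?_⟩
  set G := upperModulus F with hG
  have hGm : Measurable (Function.uncurry G) := measurable_upperModulus hF.continuousOn
  set A : ℝ → ℝ → ℝ≥0∞ := fun x y => ENNReal.ofReal (5 * δ ^ 2) * circleMean G x y with hA
  have hAm : Measurable (Function.uncurry A) := (measurable_circleMean hGm).const_mul _
  have hGN : mixedPow W p q G = N := by
    rw [hN]
    exact le_antisymm (mixedPow_mono hp0 hq0 fun x y hy => (upperModulus_of_pos F x hy).le)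
      (mixedPow_mono hp0 hq0 fun x y hy => (upperModulus_of_pos F x hy).ge)
  have hAN : mixedPow W p q A ≤ ENNReal.ofReal ((5 * δ ^ 2) ^ q) * (ENNReal.ofReal D * N) := by
    rw [mixedPow_const_mul hp0 hq0 ENNReal.ofReal_ne_top,
      ENNReal.ofReal_rpow_of_nonneg (by positivity) hq0.le]
    gcongr
    refine (mixedPow_circleMean_le hW (fun _ => ENNReal.ofReal_ne_top) (K := ENNReal.ofReal K)
      ?_ hp hq hGm).trans ?_
    · intro c y hc hc4 hy
      rw [← ENNReal.ofReal_mul (by linarith)]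
      exact ENNReal.ofReal_le_ofReal (hw.le _ _ hy (by positivity) (by nlinarith) (by nlinarith))
    · rw [hGN]
      gcongr
      rw [ENNReal.ofReal_rpow_of_nonneg (by positivity) hq0.le, ← ENNReal.ofReal_ofNat,
        ← ENNReal.ofReal_mul (by norm_num), ← ENNReal.ofReal_mul (by positivity)]
      exact ENNReal.ofReal_le_ofReal (le_max_right _ _)
  have hosc : ∀ x y : ℝ, 0 < y →
      ‖F ((x : ℂ) + (y : ℂ) * Complex.I) - F (corner δ γ x y)‖ₑ ≤ A x y := by
    intro x y hy
    have := enorm_sub_le_circleMean hF hy (by nlinarith) (norm_sub_corner_le hδ hδ1 hγ x hy)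
    rwa [show 8 * (5 / 8 * δ ^ 2) = 5 * δ ^ 2 by ring] at this
  have hfin : ∀ T : ℝ≥0∞, ENNReal.ofReal B * (T + mixedPow W p q A) ≤
      ENNReal.ofReal (B * D) * (T + ENNReal.ofReal ((5 * δ ^ 2) ^ q) * N) := by
    intro T
    rw [ENNReal.ofReal_mul hB0.le, mul_assoc]
    gcongr
    rw [mul_add]
    gcongr
    · exact le_mul_of_one_le_left zero_le (by simpa using ENNReal.ofReal_le_ofReal hD1)
    · rw [mul_left_comm]; exact hAN
  constructor
  · refine le_trans ?_ (hfin N)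
    rw [hS, ← hBeq, ← hGN]
    refine le_trans (mixedPow_mono hp0 hq0 fun x y hy => ?_) (mixedPow_add_le hW hp0 hq0 G hAm)
    rw [hG, upperModulus_of_pos F x hy]
    refine le_trans ?_ (add_le_add_right (hosc x y hy) _)
    have := enorm_sub_le (a := F ((x : ℂ) + (y : ℂ) * Complex.I))
      (b := F ((x : ℂ) + (y : ℂ) * Complex.I) - F (corner δ γ x y))
    rwa [sub_sub_cancel] at this
  · refine le_trans ?_ (hfin S)
    rw [hS, ← hBeq, hN]
    refine le_trans (mixedPow_mono hp0 hq0 fun x y hy => ?_) (mixedPow_add_le hW hp0 hq0 _ hAm)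
    refine le_trans ?_ (add_le_add_right (hosc x y hy) _)
    have := enorm_add_le (F (corner δ γ x y))
      (F ((x : ℂ) + (y : ℂ) * Complex.I) - F (corner δ γ x y))
    rwa [add_sub_cancel] at this

/-- Cancelling half of `N` in `ℝ≥0∞` requires `N` to be finite; for the main theorem this is
membership in the Bergman space. -/
theorem le_two_mul_of_le_add_half {N T : ℝ≥0∞} (hN : N ≠ ∞) (h : N ≤ T + 2⁻¹ * N) :
    N ≤ 2 * T := by
  have e : N = 2⁻¹ * N + 2⁻¹ * N := by rw [← add_mul, ENNReal.inv_two_add_inv_two, one_mul]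
  conv_lhs at h => rw [e]
  have h' := (ENNReal.add_le_add_iff_right (ENNReal.mul_ne_top (by simp) hN)).1 h
  rw [mul_comm, ← div_eq_mul_inv] at h'
  rw [mul_comm]
  exact (ENNReal.div_le_iff (by simp) (by simp)).1 h'

end MixedBergman

end

open MixedBergman in
theorem mainTheorem5 (α p q k : ℝ) (hα : -1 < α) (hp : 1 < p) (hq : 1 < q)
    (Φ : ℝ≥0 → ℝ≥0) (hΦ : Φ ∈ MixedBergman.classL ∪ MixedBergman.classU)
    (ε₁ ε₂ : ℝ) (hε₁ : ε₁ = 0 ∨ ε₁ = 1) (hε₂ : ε₂ = 0 ∨ ε₂ = 1)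
    (Ω : ℝ → ℝ) (hΩ : Ω = fun t : ℝ => MixedBergman.growthWeight Φ ε₁ ε₂ t ^ k) :
    ∃ δ₀ : ℝ, 0 < δ₀ ∧ ∀ δ : ℝ, 0 < δ → δ < 1 →
      ∃ C : ℝ, 0 < C ∧ ∀ γ : ℝ, MixedBergman.IsLatticeExponent δ γ →
        ∀ F : ℂ → ℂ, F ∈ MixedBergman.mixedBergman Ω α p q →
          MixedBergman.discreteNormPow Ω α p q δ γ F ≤
              ENNReal.ofReal C * MixedBergman.mixedNormPow Ω α p q F ∧
            (δ < δ₀ →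
              MixedBergman.mixedNormPow Ω α p q F ≤
                ENNReal.ofReal C * MixedBergman.discreteNormPow Ω α p q δ γ F) := by
  have hε₁' : 0 ≤ ε₁ := by rcases hε₁ with h | h <;> simp [h]
  have hε₂' : 0 ≤ ε₂ := by rcases hε₂ with h | h <;> simp [h]
  obtain ⟨K, hw⟩ := exists_isModerateWeight hΦ hε₁' hε₂' k α
  have hw' : IsModerateWeight K fun t => Ω t * t ^ α := by rw [hΩ]; exact hw
  obtain ⟨E, hE, hcomp⟩ := exists_mixedPow_comparison hw' hp hq
  have hp0 : 0 < p := by linarith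
  have hq0 : 0 < q := by linarith
  have hK : 0 < K := by linarith [hw.one_le]
  -- From `δ < 1 / 5` and `q > 1`, `(5 * δ ^ 2) ^ q ≤ 5 * δ ^ 2 ≤ δ`; then `δ < 1 / (2 * E)` makes
  -- the error at most half the norm.
  refine ⟨min (1 / 5) (1 / (2 * E)), by positivity, fun δ hδ hδ1 => ?_⟩
  set c₁ : ℝ := (δ ^ 2 / 8) ^ (q / p) * K with hc₁
  set c₂ : ℝ := ((δ ^ 2 / 8) ^ (q / p))⁻¹ * (K * (150 / δ ^ 2)) with hc₂
  have hc₁0 : 0 < c₁ := by positivity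
  have hc₂0 : 0 < c₂ := by positivity
  refine ⟨max (c₂ * (E * (1 + (5 * δ ^ 2) ^ q))) (2 * E * c₁), by positivity,
    fun γ hγ F hF => ?_⟩
  obtain ⟨hd₁, hd₂⟩ := discrete_bounds hδ hδ1 hγ hw' hp0 hq0 F
  obtain ⟨hs, hn⟩ := hcomp δ γ hδ hδ1 hγ F hF.2 _ _ rfl rfl
  rw [← mixedNormPow_eq_mixedPow] at hs hn
  set N := mixedNormPow Ω α p q F with hN
  set S := mixedPow (fun y => ENNReal.ofReal (Ω y * y ^ α)) p q
    (fun x y => ‖F (corner δ γ x y)‖ₑ) with hS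
  constructor
  · calc discreteNormPow Ω α p q δ γ F ≤ ENNReal.ofReal c₂ * S := hd₂
      _ ≤ ENNReal.ofReal c₂ *
          (ENNReal.ofReal E * (N + ENNReal.ofReal ((5 * δ ^ 2) ^ q) * N)) := by gcongr
      _ = ENNReal.ofReal (c₂ * (E * (1 + (5 * δ ^ 2) ^ q))) * N := by
          rw [ENNReal.ofReal_mul hc₂0.le, ENNReal.ofReal_mul hE.le,
            ENNReal.ofReal_add zero_le_one (by positivity), ENNReal.ofReal_one]
          ring
      _ ≤ _ := by gcongr; exact le_max_left _ _
  · intro hδ₀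
    have h5 : δ < 1 / 5 := hδ₀.trans_le (min_le_left _ _)
    have hE' : δ < 1 / (2 * E) := hδ₀.trans_le (min_le_right _ _)
    have hsmall : E * (5 * δ ^ 2) ^ q ≤ 2⁻¹ := by
      have h1 : 5 * δ ^ 2 ≤ δ := by nlinarith
      have h2 : (5 * δ ^ 2) ^ q ≤ 5 * δ ^ 2 := by
        simpa using Real.rpow_le_rpow_of_exponent_ge (by positivity) (h1.trans hδ1.le) hq.le
      rw [lt_div_iff₀ (by positivity)] at hE'
      nlinarith
    have hhalf : N ≤ ENNReal.ofReal E * S + 2⁻¹ * N := by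
      refine hn.trans ?_
      rw [mul_add, ← mul_assoc (ENNReal.ofReal E), ← ENNReal.ofReal_mul hE.le]
      gcongr
      refine (ENNReal.ofReal_le_ofReal hsmall).trans_eq ?_
      rw [ENNReal.ofReal_inv_of_pos two_pos, ENNReal.ofReal_ofNat]
    calc N ≤ 2 * (ENNReal.ofReal E * S) := le_two_mul_of_le_add_half hF.1.2.ne hhalf
      _ ≤ 2 * (ENNReal.ofReal E * (ENNReal.ofReal c₁ * discreteNormPow Ω α p q δ γ F)) := by gcongr
      _ = ENNReal.ofReal (2 * E * c₁) * discreteNormPow Ω α p q δ γ F := by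
          rw [ENNReal.ofReal_mul (p := 2 * E) (by positivity), ENNReal.ofReal_mul zero_le_two,
            ENNReal.ofReal_ofNat]
          ring
      _ ≤ _ := by gcongr; exact le_max_right _ _
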